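/- Fix a vocabulary with countably infinitely many objects, object variables and numeric variables, and with countably infinitely many predicates for each arity $n\ge 0$ and each assignment of a sort (object or numeric) to the positions $1,\dots,n$. An object term is an object or an object variable; a numeric term is an integer, a numeric variable, or $s_1+s_2$, $s_1-s_2$ or $s_1\times s_2$ with $s_1,s_2$ numeric terms. A standard atom is $B(t_1,\dots,t_n)$ with $B$ a predicate of arity $n$ and each $t_i$ a term of the sort of position $i$ of $B$; a comparison atom is $(s_1<s_2)$ or $(s_1\le s_2)$ with $s_1,s_2$ numeric terms. A rule is $\bigwedge_i\alpha_i\wedge\bigwedge_j\beta_j\to\alpha$ with finitely many standard atoms $\alpha_i$, finitely many comparison atoms $\beta_j$ and a standard atom $\alpha$ (the body may be empty), such that each variable of the rule occurs in some $\alpha_i$. A program of Datalog with integer arithmetic is a finite set of rules. A fact is a standard atom whose arguments are all objects or integers. An interpretation is a (possibly infinite) set $I$ of facts; it is a model of a program $\mathcal P$ if, for every rule of $\mathcal P$ and every substitution of objects for its object variables and integers for its numeric variables, the following holds: if the evaluated standard body atoms belong to $I$ and the evaluated comparison atoms are true over $\mathbb Z$, then the evaluated head belongs to $I$. We write $\mathcal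 P\models\alpha$ if the fact $\alpha$ belongs to every model of $\mathcal P$. Theorem. Given a program $\mathcal P$ and a fact $\alpha$ as input, checking $\mathcal P\models\alpha$ is undecidable, even if $\mathcal P$ contains no $\times$ or $-$ and each standard atom in $\mathcal P$ has at most one numeric term among its arguments. That is, no algorithm decides $\mathcal P\models\alpha$ correctly for all facts $\alpha$ and all programs $\mathcal P$ of this restricted form. -/

import Mathlib

namespace DatalogZ

/-! ## Syntax

The vocabulary is the standard countably infinite one: objects, object variables and numeric
variables are each named by natural numbers, and there are infinitely many predicates for every
arity and every assignment of sorts to the argument positions. -/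

/-- The two sorts of argument positions. -/
inductive Srt : Type
  | object
  | numeric

/-- A predicate: a name together with the list of the sorts of its positions; the arity is the
length of that list. -/
structure Predicate : Type where
  name : ℕ
  sorts : List Srt

/-- Variables of either sort. -/
inductive Var : Type
  | objVar (x : ℕ)
  | numVar (x : ℕ)

/-- Object terms: objects and object variables. -/
inductive ObjTerm : Type
  | obj (a : ℕ)
  | var (x : ℕ)

/-- Numeric terms: integers, numeric variables, sums, differences and products. -/
inductive NumTerm : Type
  | int (k : ℤ)
  | var (x : ℕ)
  | add (s t : NumTerm)
  | sub (s t : NumTerm)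
  | mul (s t : NumTerm)

/-- Terms of either sort. -/
inductive Term : Type
  | object (t : ObjTerm)
  | numeric (s : NumTerm)

/-- Constants: objects and integers. -/
inductive Constant : Type
  | object (a : ℕ)
  | int (k : ℤ)

/-- Standard atoms `B(t₁, …, tₙ)`; see `StdAtom.WellSorted` for the sort condition. -/
structure StdAtom : Type where
  pred : Predicate
  args : List Term

/-- Comparison atoms `(s₁ < s₂)` and `(s₁ ≤ s₂)`. -/
inductive CompAtom : Type
  | lt (s₁ s₂ : NumTerm)
  | le (s₁ s₂ : NumTerm)

/-- Rules: standard body, comparison body, head; see `Rule.WellFormed`. -/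
structure Rule : Type where
  sbody : List StdAtom
  cbody : List CompAtom
  head : StdAtom

/-- Facts: standard atoms all of whose arguments are constants; see `Fact.WellSorted`. -/
structure Fact : Type where
  pred : Predicate
  args : List Constant

/-- A program is given by a finite list of its rules; order and repetition play no role in the
semantics. See `Program.WellFormed`. -/
abbrev Program : Type := List Rule

/-! ### Well-formedness -/

def Term.sort : Term → Srt
  | .object _ => .object
  | .numeric _ => .numeric

def Constant.sort : Constant → Srt
  | .object _ => .object
  | .int _ => .numeric

/-- The number of arguments is the arity, and each argument has the sort of its position. -/
def StdAtom.WellSorted (A : StdAtom) : Prop := A.args.map Term.sort = A.pred.sorts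

def Fact.WellSorted (f : Fact) : Prop := f.args.map Constant.sort = f.pred.sorts

def ObjTerm.vars : ObjTerm → Set Var
  | .obj _ => ∅
  | .var x => {.objVar x}

def NumTerm.vars : NumTerm → Set Var
  | .int _ => ∅
  | .var x => {.numVar x}
  | .add s t => s.vars ∪ t.vars
  | .sub s t => s.vars ∪ t.vars
  | .mul s t => s.vars ∪ t.vars

def Term.vars : Term → Set Var
  | .object t => t.vars
  | .numeric s => s.vars

def StdAtom.vars (A : StdAtom) : Set Var := {v | ∃ t ∈ A.args, v ∈ t.vars}

def CompAtom.vars : CompAtom → Set Var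
  | .lt s t => s.vars ∪ t.vars
  | .le s t => s.vars ∪ t.vars

/-- The standard atoms occurring in a rule. -/
def Rule.stdAtoms (r : Rule) : List StdAtom := r.head :: r.sbody

/-- The variables occurring in a rule. -/
def Rule.vars (r : Rule) : Set Var :=
  {v | (∃ A ∈ r.stdAtoms, v ∈ A.vars) ∨ ∃ C ∈ r.cbody, v ∈ C.vars}

/-- Standard atoms respect sorts, and each variable of the rule occurs in some standard body
atom. -/
def Rule.WellFormed (r : Rule) : Prop :=
  (∀ A ∈ r.stdAtoms, A.WellSorted) ∧ ∀ v ∈ r.vars, ∃ A ∈ r.sbody, v ∈ A.vars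

def Program.WellFormed (P : Program) : Prop := ∀ r ∈ P, r.WellFormed

/-! ### The syntactic restrictions -/

/-- The term contains neither `-` nor `×`. -/
def NumTerm.NoSubMul : NumTerm → Prop
  | .int _ => True
  | .var _ => True
  | .add s t => s.NoSubMul ∧ t.NoSubMul
  | .sub _ _ => False
  | .mul _ _ => False

def StdAtom.NoSubMul (A : StdAtom) : Prop := ∀ s : NumTerm, Term.numeric s ∈ A.args → s.NoSubMul

def CompAtom.NoSubMul : CompAtom → Prop
  | .lt s t => s.NoSubMul ∧ t.NoSubMul
  | .le s t => s.NoSubMul ∧ t.NoSubMul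

/-- The program contains neither `-` nor `×`. -/
def Program.NoSubMul (P : Program) : Prop :=
  ∀ r ∈ P, (∀ A ∈ r.stdAtoms, A.NoSubMul) ∧ ∀ C ∈ r.cbody, C.NoSubMul

def Term.isNumeric : Term → Bool
  | .object _ => false
  | .numeric _ => true

/-- Each standard atom of the program has at most one numeric term among its arguments. -/
def Program.AtMostOneNumericTerm (P : Program) : Prop :=
  ∀ r ∈ P, ∀ A ∈ r.stdAtoms, A.args.countP Term.isNumeric ≤ 1

/-! ## Semantics -/

/-- Assignments of objects to object variables and of integers to numeric variables. -/
structure Assignment : Type where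
  obj : ℕ → ℕ
  num : ℕ → ℤ

def ObjTerm.eval (σ : Assignment) : ObjTerm → ℕ
  | .obj a => a
  | .var x => σ.obj x

def NumTerm.eval (σ : Assignment) : NumTerm → ℤ
  | .int k => k
  | .var x => σ.num x
  | .add s t => s.eval σ + t.eval σ
  | .sub s t => s.eval σ - t.eval σ
  | .mul s t => s.eval σ * t.eval σ

def Term.eval (σ : Assignment) : Term → Constant
  | .object t => .object (t.eval σ)
  | .numeric s => .int (s.eval σ)

/-- The fact obtained from a standard atom by substituting its variables according to `σ` and
evaluating the arithmetic functions. -/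
def StdAtom.eval (σ : Assignment) (A : StdAtom) : Fact := ⟨A.pred, A.args.map (Term.eval σ)⟩

def CompAtom.Holds (σ : Assignment) : CompAtom → Prop
  | .lt s t => s.eval σ < t.eval σ
  | .le s t => s.eval σ ≤ t.eval σ

/-- A (Herbrand) interpretation: a possibly infinite set of (well-sorted) facts. -/
structure Interpretation : Type where
  facts : Set Fact
  wellSorted : ∀ f ∈ facts, f.WellSorted

/-- `I` satisfies the universally quantified rule `r`. -/
def Interpretation.SatisfiesRule (I : Interpretation) (r : Rule) : Prop :=
  ∀ σ : Assignment,
    (∀ A ∈ r.sbody, A.eval σ ∈ I.facts) → (∀ C ∈ r.cbody, C.Holds σ) → r.head.eval σ ∈ I.facts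

/-- `I` is a model of `P`. -/
def Interpretation.IsModel (I : Interpretation) (P : Program) : Prop :=
  ∀ r ∈ P, I.SatisfiesRule r

/-- `P` entails the fact `α`. -/
def Program.Entails (P : Program) (α : Fact) : Prop :=
  ∀ I : Interpretation, I.IsModel P → α ∈ I.facts

/-! ## Effective coding of programs and facts

Explicit Gödel numberings, so that programs and facts can be inputs of algorithms. -/

/-- Gödel numbering of numeric terms. -/
def NumTerm.toNat : NumTerm → ℕ
  | .int k => 5 * Encodable.encode k
  | .var x => 5 * x + 1
  | .add s t => 5 * Nat.pair s.toNat t.toNat + 2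
  | .sub s t => 5 * Nat.pair s.toNat t.toNat + 3
  | .mul s t => 5 * Nat.pair s.toNat t.toNat + 4

/-- The inverse of `NumTerm.toNat`. -/
def NumTerm.ofNat (n : ℕ) : NumTerm :=
  if _h₀ : n % 5 = 0 then .int (Denumerable.ofNat ℤ (n / 5))
  else if _h₁ : n % 5 = 1 then .var (n / 5)
  else
    have _hl : (n / 5).unpair.1 < n := lt_of_le_of_lt (Nat.unpair_left_le _) (by omega)
    have _hr : (n / 5).unpair.2 < n := lt_of_le_of_lt (Nat.unpair_right_le _) (by omega)
    if n % 5 = 2 then .add (NumTerm.ofNat (n / 5).unpair.1) (NumTerm.ofNat (n / 5).unpair.2)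
    else if n % 5 = 3 then .sub (NumTerm.ofNat (n / 5).unpair.1) (NumTerm.ofNat (n / 5).unpair.2)
    else .mul (NumTerm.ofNat (n / 5).unpair.1) (NumTerm.ofNat (n / 5).unpair.2)
termination_by n

theorem NumTerm.ofNat_toNat (s : NumTerm) : NumTerm.ofNat s.toNat = s := by
  induction s with
  | int k =>
    rw [NumTerm.ofNat, NumTerm.toNat, dif_pos (by omega), Nat.mul_div_cancel_left _ (by norm_num),
      Denumerable.ofNat_encode]
  | var x =>
    rw [NumTerm.ofNat, NumTerm.toNat, dif_neg (by omega), dif_pos (by omega),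
      show (5 * x + 1) / 5 = x by omega]
  | add s t hs ht =>
    rw [NumTerm.ofNat, NumTerm.toNat, dif_neg (by omega), dif_neg (by omega)]
    simp only [show ∀ m, (5 * m + 2) / 5 = m by omega, show ∀ m, (5 * m + 2) % 5 = 2 by omega,
      Nat.unpair_pair, hs, ht, if_true]
  | sub s t hs ht =>
    rw [NumTerm.ofNat, NumTerm.toNat, dif_neg (by omega), dif_neg (by omega)]
    simp [show ∀ m, (5 * m + 3) / 5 = m by omega, show ∀ m, (5 * m + 3) % 5 = 3 by omega, hs, ht]
  | mul s t hs ht =>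
    rw [NumTerm.ofNat, NumTerm.toNat, dif_neg (by omega), dif_neg (by omega)]
    simp [show ∀ m, (5 * m + 4) / 5 = m by omega, show ∀ m, (5 * m + 4) % 5 = 4 by omega, hs, ht]

theorem NumTerm.toNat_ofNat (n : ℕ) : (NumTerm.ofNat n).toNat = n := by
  induction n using Nat.strong_induction_on with
  | _ n ih =>
    rw [NumTerm.ofNat]
    split_ifs with h₀ h₁ h₂ h₃
    · simp only [NumTerm.toNat, Denumerable.encode_ofNat]; omega
    · simp only [NumTerm.toNat]; omega
    all_goals
      have hl : (n / 5).unpair.1 < n := lt_of_le_of_lt (Nat.unpair_left_le _) (by omega)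
      have hr : (n / 5).unpair.2 < n := lt_of_le_of_lt (Nat.unpair_right_le _) (by omega)
      simp only [NumTerm.toNat, ih _ hl, ih _ hr, Nat.pair_unpair]
      omega

def NumTerm.equivNat : NumTerm ≃ ℕ where
  toFun := NumTerm.toNat
  invFun := NumTerm.ofNat
  left_inv := NumTerm.ofNat_toNat
  right_inv := NumTerm.toNat_ofNat

def Srt.equivBool : Srt ≃ Bool where
  toFun | .object => false | .numeric => true
  invFun | false => .object | true => .numeric
  left_inv s := by cases s <;> rfl
  right_inv b := by cases b <;> rfl

def Predicate.equivProd : Predicate ≃ ℕ × List Srt where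
  toFun p := (p.name, p.sorts)
  invFun p := ⟨p.1, p.2⟩
  left_inv _ := rfl
  right_inv _ := rfl

def ObjTerm.equivSum : ObjTerm ≃ ℕ ⊕ ℕ where
  toFun | .obj a => .inl a | .var x => .inr x
  invFun | .inl a => .obj a | .inr x => .var x
  left_inv t := by cases t <;> rfl
  right_inv t := by cases t <;> rfl

def Term.equivSum : Term ≃ ObjTerm ⊕ NumTerm where
  toFun | .object t => .inl t | .numeric s => .inr s
  invFun | .inl t => .object t | .inr s => .numeric s
  left_inv t := by cases t <;> rfl
  right_inv t := by cases t <;> rfl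

def Constant.equivSum : Constant ≃ ℕ ⊕ ℤ where
  toFun | .object a => .inl a | .int k => .inr k
  invFun | .inl a => .object a | .inr k => .int k
  left_inv c := by cases c <;> rfl
  right_inv c := by cases c <;> rfl

def StdAtom.equivProd : StdAtom ≃ Predicate × List Term where
  toFun A := (A.pred, A.args)
  invFun p := ⟨p.1, p.2⟩
  left_inv _ := rfl
  right_inv _ := rfl

def CompAtom.equivSum : CompAtom ≃ (NumTerm × NumTerm) ⊕ (NumTerm × NumTerm) where
  toFun | .lt s t => .inl (s, t) | .le s t => .inr (s, t)
  invFun | .inl p => .lt p.1 p.2 | .inr p => .le p.1 p.2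
  left_inv C := by cases C <;> rfl
  right_inv C := by cases C <;> rfl

def Rule.equivProd : Rule ≃ List StdAtom × List CompAtom × StdAtom where
  toFun r := (r.sbody, r.cbody, r.head)
  invFun p := ⟨p.1, p.2.1, p.2.2⟩
  left_inv _ := rfl
  right_inv _ := rfl

def Fact.equivProd : Fact ≃ Predicate × List Constant where
  toFun f := (f.pred, f.args)
  invFun p := ⟨p.1, p.2⟩
  left_inv _ := rfl
  right_inv _ := rfl

instance : Primcodable NumTerm := Primcodable.ofEquiv ℕ NumTerm.equivNat
instance : Primcodable Srt := Primcodable.ofEquiv Bool Srt.equivBool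
instance : Primcodable Predicate := Primcodable.ofEquiv (ℕ × List Srt) Predicate.equivProd
instance : Primcodable ObjTerm := Primcodable.ofEquiv (ℕ ⊕ ℕ) ObjTerm.equivSum
instance : Primcodable Term := Primcodable.ofEquiv (ObjTerm ⊕ NumTerm) Term.equivSum
instance : Primcodable Constant := Primcodable.ofEquiv (ℕ ⊕ ℤ) Constant.equivSum
instance : Primcodable StdAtom := Primcodable.ofEquiv (Predicate × List Term) StdAtom.equivProd
instance : Primcodable CompAtom :=
  Primcodable.ofEquiv ((NumTerm × NumTerm) ⊕ (NumTerm × NumTerm)) CompAtom.equivSum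
instance : Primcodable Rule :=
  Primcodable.ofEquiv (List StdAtom × List CompAtom × StdAtom) Rule.equivProd
instance : Primcodable Fact := Primcodable.ofEquiv (Predicate × List Constant) Fact.equivProd

end DatalogZ

/-! The proof reduces the halting problem to entailment. The obstacle is that an atom carries only
one numeric term, whereas the graph of a function is a binary relation. A pair `(a, b)` is therefore
packed into the single integer `2 ^ (a + b) + a`, the leading power of two serving as a separator
(`two_pow_add_inj`, `code_inj`).

Addition and comparison suffice to unpack it. The sets `{2 ^ k}` and `{2 ^ k + k}` are definable by
unary rules, and if `p` is a power of two, `s < p` and `p + s` has the form `2 ^ l + l`, then `p = 2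
^ s`. Adding such guards to the body turns any rule over binary relations of natural numbers into an
admissible rule. `RelRule.satisfiesRule_toRule` and `RelRule.valid_of_satisfiesRule` transfer
validity in the two directions.

Binary rules compute every partial recursive function: squares arise by recursion from addition,
squares give `Nat.pair` and its projections, and each constructor of `Code` becomes one or two
rules. The intended relations satisfy the rules (`valid_codeRules`), and relations satisfying them
contain the graphs (`codeRules_complete`). Hence the program of `c` entails the fact for `(a, b)`
exactly when `b ∈ c.eval a` (`entails_graphFact`). For a fixed code that simulates all codes on
input `0`, only the queried fact varies, and deciding entailment would decide halting. -/

namespace DatalogZ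

open Nat.Partrec (Code)

/-! ## Terms and rules over the natural numbers -/

/-- Terms built from natural numbers and variables by addition. -/
inductive NatTerm : Type
  | const (k : ℕ)
  | var (x : ℕ)
  | add (s t : NatTerm)

namespace NatTerm

def eval (v : ℕ → ℕ) : NatTerm → ℕ
  | .const k => k
  | .var x => v x
  | .add s t => s.eval v + t.eval v

/-- The numeric term of a `NatTerm`. Variables are sent to even variables; the odd ones are kept
free for powers of two. -/
def toNum : NatTerm → NumTerm
  | .const k => .int k
  | .var x => .var (2 * x)
  | .add s t => .add s.toNum t.toNum

def varList : NatTerm → List ℕ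
  | .const _ => []
  | .var x => [x]
  | .add s t => s.varList ++ t.varList

theorem noSubMul_toNum (t : NatTerm) : t.toNum.NoSubMul := by
  induction t with
  | const | var => trivial
  | add s t hs ht => exact ⟨hs, ht⟩

theorem mem_vars_toNum {t : NatTerm} {v : Var} (h : v ∈ t.toNum.vars) :
    ∃ x ∈ t.varList, v = .numVar (2 * x) := by
  induction t with
  | const => exact h.elim
  | var x => exact ⟨x, by simp [varList], h⟩
  | add s t hs ht =>
    rcases h with h | h
    · obtain ⟨x, hx, rfl⟩ := hs h
      exact ⟨x, by simp [varList, hx], rfl⟩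
    · obtain ⟨x, hx, rfl⟩ := ht h
      exact ⟨x, by simp [varList, hx], rfl⟩

theorem eval_toNum {σ : Assignment} {v : ℕ → ℕ} {t : NatTerm}
    (h : ∀ x ∈ t.varList, σ.num (2 * x) = v x) : t.toNum.eval σ = (t.eval v : ℤ) := by
  induction t with
  | const => rfl
  | var x => exact h x (by simp [varList])
  | add s t hs ht =>
    simp only [toNum, NumTerm.eval, eval, Nat.cast_add]
    rw [hs fun x hx => h x (by simp [varList, hx]), ht fun x hx => h x (by simp [varList, hx])]

end NatTerm

/-- A binary atom over the natural numbers. -/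
structure RelAtom : Type where
  name : ℕ
  fst : NatTerm
  snd : NatTerm

/-- A rule over binary relations of natural numbers; the pair `(s, t)` in `cmp` stands for
`s ≤ t`. -/
structure RelRule : Type where
  body : List RelAtom
  cmp : List (NatTerm × NatTerm)
  head : RelAtom

def RelAtom.Holds (G : ℕ → ℕ → ℕ → Prop) (v : ℕ → ℕ) (A : RelAtom) : Prop :=
  G A.name (A.fst.eval v) (A.snd.eval v)

/-- The relations are a parameter because validity is needed both for the intended relations
`stdRel` and for those read off an arbitrary model. -/
def RelRule.Valid (G : ℕ → ℕ → ℕ → Prop) (r : RelRule) : Prop :=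
  ∀ v, (∀ A ∈ r.body, A.Holds G v) → (∀ p ∈ r.cmp, p.1.eval v ≤ p.2.eval v) → r.head.Holds G v

/-- The coding of pairs of natural numbers by single numbers: the pair can be recovered by means
of the sets `{2 ^ k}` and `{2 ^ k + k}` and addition only. -/
def code (a b : ℕ) : ℕ := 2 ^ (a + b) + a

/-- Both sides lie in dyadic intervals `[2 ^ k, 2 ^ (k + 1))`, and these are disjoint for distinct
exponents. -/
theorem two_pow_add_inj {k l a b : ℕ} (ha : a < 2 ^ k) (hb : b < 2 ^ l)
    (h : 2 ^ k + a = 2 ^ l + b) : k = l ∧ a = b := by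
  have hkl : k = l := by
    rcases lt_trichotomy k l with hlt | heq | hlt
    · have := Nat.pow_le_pow_right (n := 2) (by norm_num) hlt
      rw [pow_succ] at this
      omega
    · exact heq
    · have := Nat.pow_le_pow_right (n := 2) (by norm_num) hlt
      rw [pow_succ] at this
      omega
  subst hkl
  exact ⟨rfl, by omega⟩

theorem lt_two_pow_add (a b : ℕ) : a < 2 ^ (a + b) :=
  lt_of_le_of_lt (Nat.le_add_right a b) Nat.lt_two_pow_self

theorem code_inj {a b c d : ℕ} (h : code a b = code c d) : a = c ∧ b = d := by
  obtain ⟨h₁, h₂⟩ := two_pow_add_inj (lt_two_pow_add a b) (lt_two_pow_add c d) h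
  omega

/-! ## Translation into Datalog -/

def unaryPred (X : ℕ) : Predicate := ⟨X, [.numeric]⟩

def unaryAtom (X : ℕ) (t : NumTerm) : StdAtom := ⟨unaryPred X, [.numeric t]⟩

def unaryFact (X : ℕ) (z : ℤ) : Fact := ⟨unaryPred X, [.int z]⟩

/-- The names of the predicates for natural numbers, for powers of two, and for numbers
`2 ^ k + k`. -/
abbrev natName : ℕ := 0

abbrev powName : ℕ := 1

abbrev expName : ℕ := 2

namespace RelAtom

def sum (A : RelAtom) : NatTerm := .add A.fst A.snd

/-- The variable standing for `2 ^ (a + b)`, where `a` and `b` are the arguments of the atom. -/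
def powVar (A : RelAtom) : ℕ := 2 * A.sum.toNum.toNat + 1

/-- The argument becomes `code a b` once the auxiliary variable has the value `2 ^ (a + b)`. The
shift by `3` avoids the reserved names. -/
def toStd (A : RelAtom) : StdAtom := unaryAtom (A.name + 3) (.add (.var A.powVar) A.fst.toNum)

def guards (A : RelAtom) : List StdAtom :=
  [unaryAtom powName (.var A.powVar), unaryAtom expName (.add (.var A.powVar) A.sum.toNum)]

/-- Without this bound the guards do not determine the power: for the sum `5`, the value `1` would
also pass, since `1 + 5 = 2 ^ 2 + 2`. -/
def guardComp (A : RelAtom) : CompAtom := .lt A.sum.toNum (.var A.powVar)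

end RelAtom

namespace RelRule

def atoms (r : RelRule) : List RelAtom := r.head :: r.body

def varList (r : RelRule) : List ℕ :=
  r.atoms.flatMap (fun A => A.sum.varList) ++
    r.cmp.flatMap fun p => p.1.varList ++ p.2.varList

/-- The `natName` atoms bind the variables and confine them to natural numbers in the intended
interpretation. The head is guarded as well, since its power variable must also occur in the body.
-/
def toRule (r : RelRule) : Rule where
  sbody := r.varList.map (fun x => unaryAtom natName (.var (2 * x))) ++
    (r.atoms.flatMap RelAtom.guards ++ r.body.map RelAtom.toStd)
  cbody := r.atoms.map RelAtom.guardComp ++ r.cmp.map fun p => .le p.1.toNum p.2.toNum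
  head := r.head.toStd

end RelRule

/-! ### Admissibility of the translated rules -/

theorem wellSorted_unaryAtom (X : ℕ) (t : NumTerm) : (unaryAtom X t).WellSorted := rfl

theorem mem_vars_unaryAtom {X : ℕ} {t : NumTerm} {v : Var} :
    v ∈ (unaryAtom X t).vars ↔ v ∈ t.vars := by
  simp [StdAtom.vars, unaryAtom, Term.vars]

theorem noSubMul_unaryAtom {X : ℕ} {t : NumTerm} (h : t.NoSubMul) : (unaryAtom X t).NoSubMul := by
  intro s hs
  simp only [unaryAtom, List.mem_singleton, Term.numeric.injEq] at hs
  exact hs ▸ h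

/-- The conditions that the input programs have to satisfy, rule by rule. -/
structure Rule.Admissible (r : Rule) : Prop where
  wellFormed : r.WellFormed
  noSubMul : (∀ A ∈ r.stdAtoms, A.NoSubMul) ∧ ∀ C ∈ r.cbody, C.NoSubMul
  atMostOne : ∀ A ∈ r.stdAtoms, A.args.countP Term.isNumeric ≤ 1

theorem Rule.admissible_of_unary {r : Rule}
    (hs : ∀ A ∈ r.stdAtoms, ∃ X t, A = unaryAtom X t ∧ t.NoSubMul)
    (hc : ∀ C ∈ r.cbody, C.NoSubMul)
    (hv : ∀ v ∈ r.vars, ∃ A ∈ r.sbody, v ∈ A.vars) : r.Admissible := by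
  refine ⟨⟨fun A hA => ?_, hv⟩, ⟨fun A hA => ?_, hc⟩, fun A hA => ?_⟩ <;>
    obtain ⟨X, t, rfl, ht⟩ := hs A hA
  · exact wellSorted_unaryAtom X t
  · exact noSubMul_unaryAtom ht
  · simp [unaryAtom, List.countP_cons, Term.isNumeric]

namespace RelRule

theorem mem_stdAtoms_toRule {r : RelRule} {B : StdAtom} (h : B ∈ r.toRule.stdAtoms) :
    (∃ x ∈ r.varList, B = unaryAtom natName (.var (2 * x))) ∨
      ∃ A ∈ r.atoms, B ∈ A.guards ∨ B = A.toStd := by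
  simp only [Rule.stdAtoms, toRule, List.mem_cons, List.mem_append, List.mem_map,
    List.mem_flatMap] at h
  rcases h with rfl | ⟨x, hx, rfl⟩ | ⟨A, hA, hB⟩ | ⟨A, hA, rfl⟩
  · exact .inr ⟨r.head, by simp [atoms], .inr rfl⟩
  · exact .inl ⟨x, hx, rfl⟩
  · exact .inr ⟨A, hA, .inl hB⟩
  · exact .inr ⟨A, by simp [atoms, hA], .inr rfl⟩

theorem admissible_toRule (r : RelRule) : r.toRule.Admissible := by
  have hnat : ∀ x ∈ r.varList, ∃ A ∈ r.toRule.sbody, Var.numVar (2 * x) ∈ A.vars := fun x hx =>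
    ⟨_, List.mem_append_left _ (List.mem_map_of_mem hx), by
      simp [mem_vars_unaryAtom, NumTerm.vars]⟩
  have hpow : ∀ A ∈ r.atoms, ∃ B ∈ r.toRule.sbody, Var.numVar A.powVar ∈ B.vars := fun A hA =>
    ⟨unaryAtom powName (.var A.powVar),
      List.mem_append_right _ (List.mem_append_left _
        (List.mem_flatMap.2 ⟨A, hA, by simp [RelAtom.guards]⟩)), by
      simp [mem_vars_unaryAtom, NumTerm.vars]⟩
  have hsum : ∀ A ∈ r.atoms, ∀ x ∈ A.sum.varList, x ∈ r.varList := fun A hA x hx =>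
    List.mem_append_left _ (List.mem_flatMap.2 ⟨A, hA, hx⟩)
  have hfst : ∀ A : RelAtom, ∀ x ∈ A.fst.varList, x ∈ A.sum.varList := fun A x hx =>
    List.mem_append_left _ hx
  refine Rule.admissible_of_unary (fun B hB => ?_) (fun C hC => ?_) fun v hv => ?_
  · rcases mem_stdAtoms_toRule hB with ⟨x, -, rfl⟩ | ⟨A, -, hB | rfl⟩
    · exact ⟨_, _, rfl, trivial⟩
    · simp only [RelAtom.guards, List.mem_cons, List.not_mem_nil, or_false] at hB
      rcases hB with rfl | rfl
      · exact ⟨_, _, rfl, trivial⟩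
      · exact ⟨_, _, rfl, trivial, NatTerm.noSubMul_toNum _⟩
    · exact ⟨_, _, rfl, trivial, NatTerm.noSubMul_toNum _⟩
  · simp only [toRule, List.mem_append, List.mem_map] at hC
    rcases hC with ⟨A, -, rfl⟩ | ⟨p, -, rfl⟩
    · exact ⟨NatTerm.noSubMul_toNum _, trivial⟩
    · exact ⟨NatTerm.noSubMul_toNum _, NatTerm.noSubMul_toNum _⟩
  · rcases hv with ⟨B, hB, hv⟩ | ⟨C, hC, hv⟩
    · rcases mem_stdAtoms_toRule hB with ⟨x, hx, rfl⟩ | ⟨A, hA, hB | rfl⟩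
      · rw [mem_vars_unaryAtom] at hv
        obtain rfl : v = _ := hv
        exact hnat x hx
      · simp only [RelAtom.guards, List.mem_cons, List.not_mem_nil, or_false] at hB
        rcases hB with rfl | rfl <;> rw [mem_vars_unaryAtom] at hv
        · obtain rfl : v = _ := hv
          exact hpow A hA
        · rcases hv with hv | hv
          · obtain rfl : v = _ := hv
            exact hpow A hA
          · obtain ⟨x, hx, rfl⟩ := NatTerm.mem_vars_toNum hv
            exact hnat x (hsum A hA x hx)
      · rw [RelAtom.toStd, mem_vars_unaryAtom] at hv
        rcases hv with hv | hv
        · obtain rfl : v = _ := hv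
          exact hpow A hA
        · obtain ⟨x, hx, rfl⟩ := NatTerm.mem_vars_toNum hv
          exact hnat x (hsum A hA x (hfst A x hx))
    · simp only [toRule, List.mem_append, List.mem_map] at hC
      rcases hC with ⟨A, hA, rfl⟩ | ⟨p, hp, rfl⟩
      · rcases hv with hv | hv
        · obtain ⟨x, hx, rfl⟩ := NatTerm.mem_vars_toNum hv
          exact hnat x (hsum A hA x hx)
        · obtain rfl : v = _ := hv
          exact hpow A hA
      · rcases hv with hv | hv <;> obtain ⟨x, hx, rfl⟩ := NatTerm.mem_vars_toNum hv
        · exact hnat x (List.mem_append_right _ (List.mem_flatMap.2 ⟨p, hp, by simp [hx]⟩))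
        · exact hnat x (List.mem_append_right _ (List.mem_flatMap.2 ⟨p, hp, by simp [hx]⟩))

end RelRule

/-- The set of integers that an interpretation assigns to a unary numeric predicate. -/
def Interpretation.ext (I : Interpretation) (X : ℕ) : Set ℤ := {z | unaryFact X z ∈ I.facts}

/-- The relation with name `X`: the first three names are reserved for the sets that are needed
to decode pairs. -/
def Interpretation.rel (I : Interpretation) (X a b : ℕ) : Prop := (code a b : ℤ) ∈ I.ext (X + 3)

theorem eval_unaryAtom_mem {I : Interpretation} {σ : Assignment} {X : ℕ} {t : NumTerm} :
    (unaryAtom X t).eval σ ∈ I.facts ↔ t.eval σ ∈ I.ext X := Iff.rfl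

/-- Soundness of the translation: when the reserved predicates hold of nothing beyond their intended
elements, the guards force every power variable to its intended value, so body atoms decode uniquely
into pairs of `G`. -/
theorem RelRule.satisfiesRule_toRule {I : Interpretation} {G : ℕ → ℕ → ℕ → Prop} {r : RelRule}
    (hnat : ∀ z ∈ I.ext natName, 0 ≤ z)
    (hpow : ∀ z ∈ I.ext powName, ∃ k : ℕ, z = ((2 ^ k : ℕ) : ℤ))
    (hexp : ∀ z ∈ I.ext expName, ∃ k : ℕ, z = ((2 ^ k + k : ℕ) : ℤ))
    (hbody : ∀ A ∈ r.body, ∀ z ∈ I.ext (A.name + 3), ∃ a b, G A.name a b ∧ z = code a b)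
    (hhead : ∀ a b, G r.head.name a b → I.rel r.head.name a b)
    (hr : r.Valid G) : I.SatisfiesRule r.toRule := by
  intro σ hs hc
  -- Truncation of negative values is harmless: the variables of the rule are nonnegative by their
  -- `natName` atoms.
  let v : ℕ → ℕ := fun x => (σ.num (2 * x)).toNat
  have hv : ∀ x ∈ r.varList, σ.num (2 * x) = v x := fun x hx =>
    (Int.toNat_of_nonneg (hnat _ (eval_unaryAtom_mem.1
      (hs _ (List.mem_append_left _ (List.mem_map_of_mem hx)))))).symm
  have hsum : ∀ A ∈ r.atoms, ∀ x ∈ A.sum.varList, x ∈ r.varList := fun A hA x hx =>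
    List.mem_append_left _ (List.mem_flatMap.2 ⟨A, hA, hx⟩)
  have hfst : ∀ A ∈ r.atoms, A.fst.toNum.eval σ = (A.fst.eval v : ℤ) := fun A hA =>
    NatTerm.eval_toNum fun x hx => hv x (hsum A hA x (List.mem_append_left _ hx))
  have hguard : ∀ A ∈ r.atoms,
      σ.num A.powVar = ((2 ^ (A.fst.eval v + A.snd.eval v) : ℕ) : ℤ) := by
    intro A hA
    have hmem : ∀ B ∈ A.guards, B.eval σ ∈ I.facts := fun B hB =>
      hs B (List.mem_append_right _ (List.mem_append_left _ (List.mem_flatMap.2 ⟨A, hA, hB⟩)))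
    have heval : A.sum.toNum.eval σ = (A.sum.eval v : ℤ) :=
      NatTerm.eval_toNum fun x hx => hv x (hsum A hA x hx)
    obtain ⟨k, hk⟩ := hpow _ (eval_unaryAtom_mem.1
      (hmem (unaryAtom powName (.var A.powVar)) (by simp [RelAtom.guards])))
    obtain ⟨l, hl⟩ := hexp _ (eval_unaryAtom_mem.1
      (hmem (unaryAtom expName (.add (.var A.powVar) A.sum.toNum)) (by simp [RelAtom.guards])))
    have hlt : A.sum.toNum.eval σ < σ.num A.powVar :=
      hc A.guardComp (List.mem_append_left _ (List.mem_map_of_mem hA))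
    simp only [NumTerm.eval] at hk hl
    rw [heval, hk] at hl hlt
    -- With `s` the value of the sum, `2 ^ k + s = 2 ^ l + l` with both remainders below their
    -- powers, hence `k = l = s`.
    obtain ⟨h₁, h₂⟩ := two_pow_add_inj (Int.ofNat_lt.1 hlt) Nat.lt_two_pow_self
      (by exact_mod_cast hl : 2 ^ k + A.sum.eval v = 2 ^ l + l)
    rw [hk, h₁, ← h₂]
    rfl
  have hcode : ∀ A ∈ r.atoms, (NumTerm.add (.var A.powVar) A.fst.toNum).eval σ =
      (code (A.fst.eval v) (A.snd.eval v) : ℤ) := by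
    intro A hA
    simp only [NumTerm.eval, hguard A hA, hfst A hA, code, Nat.cast_add]
  have hhm : r.head ∈ r.atoms := List.mem_cons_self
  refine eval_unaryAtom_mem.2 ?_
  rw [hcode _ hhm]
  refine hhead _ _ (hr v (fun A hA => ?_) fun p hp => ?_)
  · have hA' : A ∈ r.atoms := List.mem_cons_of_mem _ hA
    obtain ⟨a, b, hab, heq⟩ := hbody A hA _ (eval_unaryAtom_mem.1
      (hs A.toStd (List.mem_append_right _ (List.mem_append_right _ (List.mem_map_of_mem hA)))))
    rw [hcode A hA'] at heq
    obtain ⟨h₁, h₂⟩ := code_inj (Int.ofNat_inj.1 heq)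
    rw [RelAtom.Holds, h₁, h₂]
    exact hab
  · have h : p.1.toNum.eval σ ≤ p.2.toNum.eval σ :=
      hc (.le p.1.toNum p.2.toNum) (List.mem_append_right _ (List.mem_map.2 ⟨p, hp, rfl⟩))
    have hx : ∀ x ∈ p.1.varList ++ p.2.varList, σ.num (2 * x) = v x := fun x hx =>
      hv x (List.mem_append_right _ (List.mem_flatMap.2 ⟨p, hp, hx⟩))
    rw [NatTerm.eval_toNum fun x h => hx x (List.mem_append_left _ h),
      NatTerm.eval_toNum fun x h => hx x (List.mem_append_right _ h)] at h
    exact_mod_cast h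

/-- The assignment extending `v` by the intended values of the auxiliary variables. -/
def liftAssignment (v : ℕ → ℕ) : Assignment where
  obj := fun _ => 0
  num := fun x => if x % 2 = 0 then (v (x / 2) : ℤ) else
    2 ^ ((NumTerm.ofNat (x / 2)).eval ⟨fun _ => 0, fun y => (v (y / 2) : ℤ)⟩).toNat

theorem liftAssignment_even (v : ℕ → ℕ) (x : ℕ) : (liftAssignment v).num (2 * x) = v x := by
  simp [liftAssignment]

/-- The odd index of the power variable contains the Gödel number of the sum, so the assignment can
decode that term and evaluate it. Atoms with the same sum share the variable, consistently, since
they need the same power. -/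
theorem liftAssignment_powVar (v : ℕ → ℕ) (A : RelAtom) :
    (liftAssignment v).num A.powVar = ((2 ^ (A.fst.eval v + A.snd.eval v) : ℕ) : ℤ) := by
  have h₁ : (2 * A.sum.toNum.toNat + 1) % 2 ≠ 0 := by omega
  have h₂ : (2 * A.sum.toNum.toNat + 1) / 2 = A.sum.toNum.toNat := by omega
  simp only [liftAssignment, RelAtom.powVar, if_neg h₁, h₂, NumTerm.ofNat_toNat]
  rw [NatTerm.eval_toNum (v := v) fun x _ => by simp]
  simp only [RelAtom.sum, NatTerm.eval, Int.toNat_natCast, Nat.cast_pow, Nat.cast_ofNat]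

/-- Completeness of the translation: the reserved predicates need only contain their intended
elements, because a single assignment, `liftAssignment v`, already satisfies all guards. -/
theorem RelRule.valid_of_satisfiesRule {I : Interpretation} {r : RelRule}
    (hnat : ∀ n : ℕ, (n : ℤ) ∈ I.ext natName)
    (hpow : ∀ k : ℕ, ((2 ^ k : ℕ) : ℤ) ∈ I.ext powName)
    (hexp : ∀ k : ℕ, ((2 ^ k + k : ℕ) : ℤ) ∈ I.ext expName)
    (hr : I.SatisfiesRule r.toRule) : r.Valid I.rel := by
  intro v hbody hcmp
  have heval : ∀ t : NatTerm, t.toNum.eval (liftAssignment v) = (t.eval v : ℤ) := fun t =>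
    NatTerm.eval_toNum fun x _ => liftAssignment_even v x
  have hcode : ∀ A : RelAtom, (NumTerm.add (.var A.powVar) A.fst.toNum).eval (liftAssignment v) =
      (code (A.fst.eval v) (A.snd.eval v) : ℤ) := by
    intro A
    simp only [NumTerm.eval, liftAssignment_powVar, heval, code, Nat.cast_add]
  have key := hr (liftAssignment v) ?_ ?_
  · have := eval_unaryAtom_mem.1 key
    rwa [hcode] at this
  · intro B hB
    simp only [toRule, List.mem_append, List.mem_map, List.mem_flatMap] at hB
    rcases hB with ⟨x, -, rfl⟩ | ⟨A, -, hB⟩ | ⟨A, hA, rfl⟩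
    · rw [eval_unaryAtom_mem, NumTerm.eval, liftAssignment_even]
      exact hnat _
    · simp only [RelAtom.guards, List.mem_cons, List.not_mem_nil, or_false] at hB
      rcases hB with rfl | rfl
      · rw [eval_unaryAtom_mem, NumTerm.eval, liftAssignment_powVar]
        exact hpow _
      · rw [eval_unaryAtom_mem, NumTerm.eval, NumTerm.eval, liftAssignment_powVar, heval,
          ← Nat.cast_add]
        exact hexp _
    · rw [RelAtom.toStd, eval_unaryAtom_mem, hcode]
      exact hbody A hA
  · intro C hC
    simp only [toRule, List.mem_append, List.mem_map] at hC
    rcases hC with ⟨A, -, rfl⟩ | ⟨p, hp, rfl⟩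
    · simp only [RelAtom.guardComp, CompAtom.Holds, heval, NumTerm.eval, liftAssignment_powVar]
      exact Int.ofNat_lt.2 Nat.lt_two_pow_self
    · simp only [CompAtom.Holds, heval]
      exact Int.ofNat_le.2 (hcmp p hp)

/-! ## The auxiliary unary predicates -/

/-- Rules generating the natural numbers, the powers of two and the numbers `2 ^ k + k`. -/
def unaryRules : Program :=
  [⟨[], [], unaryAtom natName (.int 0)⟩,
    ⟨[unaryAtom natName (.var 0)], [], unaryAtom natName (.add (.var 0) (.int 1))⟩,
    ⟨[], [], unaryAtom powName (.int 1)⟩,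
    ⟨[unaryAtom powName (.var 0)], [], unaryAtom powName (.add (.var 0) (.var 0))⟩,
    ⟨[], [], unaryAtom expName (.int 1)⟩,
    ⟨[unaryAtom expName (.var 0), unaryAtom powName (.var 1)],
      [.le (.var 1) (.var 0), .lt (.var 0) (.add (.var 1) (.var 1))],
      unaryAtom expName (.add (.add (.var 0) (.var 1)) (.int 1))⟩]

theorem admissible_unaryRules : ∀ r ∈ unaryRules, r.Admissible := by
  intro r hr
  simp only [unaryRules, List.mem_cons, List.not_mem_nil, or_false] at hr
  rcases hr with rfl | rfl | rfl | rfl | rfl | rfl <;>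
    refine Rule.admissible_of_unary ?_ ?_ ?_ <;>
    simp [Rule.stdAtoms, Rule.vars, unaryAtom, unaryPred, StdAtom.vars, CompAtom.vars, Term.vars,
      NumTerm.vars, NumTerm.NoSubMul, CompAtom.NoSubMul]
  tauto

/-- For `x = 2 ^ k + k` and `p = 2 ^ k`, the inequality `k < 2 ^ k` gives `p ≤ x < p + p`, and `x +
p + 1 = 2 ^ (k + 1) + (k + 1)`. -/
theorem unaryRules_complete {I : Interpretation} (hI : I.IsModel unaryRules) :
    (∀ n : ℕ, (n : ℤ) ∈ I.ext natName) ∧ (∀ k : ℕ, ((2 ^ k : ℕ) : ℤ) ∈ I.ext powName) ∧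
      ∀ k : ℕ, ((2 ^ k + k : ℕ) : ℤ) ∈ I.ext expName := by
  simp only [Interpretation.IsModel, unaryRules, List.forall_mem_cons, List.not_mem_nil,
    Interpretation.SatisfiesRule, eval_unaryAtom_mem, NumTerm.eval, CompAtom.Holds] at hI
  obtain ⟨hn0, hn1, hp0, hp1, he0, he1, -⟩ := hI
  have hpow : ∀ k : ℕ, ((2 ^ k : ℕ) : ℤ) ∈ I.ext powName := by
    intro k
    induction k with
    | zero => simpa using hp0 ⟨fun _ => 0, fun _ => 0⟩
    | succ k ih =>
      have := hp1 ⟨fun _ => 0, fun _ => ((2 ^ k : ℕ) : ℤ)⟩ (by simpa using ih) (by simp)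
      rwa [← Nat.cast_add, ← mul_two, ← pow_succ] at this
  refine ⟨fun n => ?_, hpow, fun k => ?_⟩
  · induction n with
    | zero => simpa using hn0 ⟨fun _ => 0, fun _ => 0⟩
    | succ n ih => simpa using hn1 ⟨fun _ => 0, fun _ => n⟩ (by simpa using ih) (by simp)
  · induction k with
    | zero => simpa using he0 ⟨fun _ => 0, fun _ => 0⟩
    | succ k ih =>
      have hk : k < 2 ^ k := Nat.lt_two_pow_self
      have := he1 ⟨fun _ => 0, fun x => if x = 0 then ((2 ^ k + k : ℕ) : ℤ) else ((2 ^ k : ℕ) : ℤ)⟩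
        ⟨by simpa using ih, by simpa using hpow k, by simp⟩
        ⟨by simp, by simp; exact_mod_cast hk, by simp⟩
      simp only [if_true, one_ne_zero, if_false] at this
      convert this using 1
      push_cast
      ring

theorem unaryRules_sound {I : Interpretation} (hnat : ∀ z, z ∈ I.ext natName ↔ 0 ≤ z)
    (hpow : ∀ z, z ∈ I.ext powName ↔ ∃ k : ℕ, z = ((2 ^ k : ℕ) : ℤ))
    (hexp : ∀ z, z ∈ I.ext expName ↔ ∃ k : ℕ, z = ((2 ^ k + k : ℕ) : ℤ)) :
    I.IsModel unaryRules := by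
  simp only [Interpretation.IsModel, unaryRules, List.forall_mem_cons, List.not_mem_nil,
    Interpretation.SatisfiesRule, eval_unaryAtom_mem, NumTerm.eval, CompAtom.Holds, hnat, hpow,
    hexp]
  refine ⟨by simp, fun σ h _ => ?_, fun _ _ _ => ⟨0, by simp⟩, fun σ h _ => ?_,
    fun _ _ _ => ⟨0, by simp⟩, fun σ h hc => ?_, by simp⟩
  · have := h.1
    omega
  · obtain ⟨k, hk⟩ := h.1
    exact ⟨k + 1, by rw [hk]; push_cast; ring⟩
  · obtain ⟨⟨k, hk⟩, ⟨l, hl⟩, -⟩ := h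
    obtain ⟨h₁, h₂, -⟩ := hc
    rw [hk, hl] at h₁ h₂
    norm_cast at h₁ h₂
    -- The comparisons place `2 ^ k + k` in `[2 ^ l, 2 ^ (l + 1))`, so its remainder over `2 ^ l` is
    -- below `2 ^ l` and uniqueness gives `k = l`.
    obtain ⟨rfl, -⟩ := two_pow_add_inj (k := k) (l := l) (a := k) (b := 2 ^ k + k - 2 ^ l)
      Nat.lt_two_pow_self (by omega) (by omega)
    exact ⟨k + 1, by rw [hk, hl]; push_cast; ring⟩

/-! ## Rules for partial recursive functions -/

abbrev squareName : ℕ := 0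

/-- The shift leaves `0` to `squareName`. -/
def codeName (c : Code) : ℕ := Encodable.encode c + 1

/-- The intended meaning of the predicates: the squaring function and the graphs of the partial
recursive functions. -/
def stdRel (X a b : ℕ) : Prop :=
  (X = squareName ∧ b = a * a) ∨ ∃ c : Code, X = codeName c ∧ b ∈ c.eval a

theorem stdRel_square {a b : ℕ} : stdRel squareName a b ↔ b = a * a := by
  constructor
  · rintro (⟨-, h⟩ | ⟨c, h, -⟩)
    · exact h
    · simp only [squareName, codeName] at h
      omega
  · exact fun h => .inl ⟨rfl, h⟩

theorem stdRel_code {c : Code} {a b : ℕ} : stdRel (codeName c) a b ↔ b ∈ c.eval a := by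
  constructor
  · rintro (⟨h, -⟩ | ⟨d, h, hd⟩)
    · simp only [squareName, codeName] at h
      omega
    · obtain rfl : c = d := Encodable.encode_injective (Nat.add_right_cancel h)
      exact hd
  · exact fun h => .inr ⟨c, rfl, h⟩

/-- Rules for squaring and for the two projections of the standard pairing function. -/
def pairingRules : List RelRule :=
  [⟨[], [], ⟨squareName, .const 0, .const 0⟩⟩,
    ⟨[⟨squareName, .var 0, .var 1⟩], [],
      ⟨squareName, .add (.var 0) (.const 1),
        .add (.var 1) (.add (.var 0) (.add (.var 0) (.const 1)))⟩⟩,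
    ⟨[⟨squareName, .var 1, .var 2⟩], [(.add (.var 0) (.const 1), .var 1)],
      ⟨codeName .left, .add (.var 2) (.var 0), .var 0⟩⟩,
    ⟨[⟨squareName, .var 1, .var 2⟩], [(.add (.var 0) (.const 1), .var 1)],
      ⟨codeName .right, .add (.var 2) (.var 0), .var 1⟩⟩,
    ⟨[⟨squareName, .var 0, .var 2⟩], [(.var 1, .var 0)],
      ⟨codeName .left, .add (.add (.var 2) (.var 0)) (.var 1), .var 0⟩⟩,
    ⟨[⟨squareName, .var 0, .var 2⟩], [(.var 1, .var 0)],
      ⟨codeName .right, .add (.add (.var 2) (.var 0)) (.var 1), .var 1⟩⟩]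

/-- Atoms stating that `k` is the pair of `a` and `b`. -/
def pairAtoms (k a b : NatTerm) : List RelAtom :=
  [⟨codeName .left, k, a⟩, ⟨codeName .right, k, b⟩]

/-- Rules computing the graph of the function with a given code. -/
def codeRules : Code → List RelRule
  | .zero => [⟨[], [], ⟨codeName .zero, .var 0, .const 0⟩⟩]
  | .succ => [⟨[], [], ⟨codeName .succ, .var 0, .add (.var 0) (.const 1)⟩⟩]
  -- The projections are already generated by `pairingRules`.
  | .left => []
  | .right => []
  | .pair f g => codeRules f ++ codeRules g ++
      [⟨[⟨codeName f, .var 0, .var 1⟩, ⟨codeName g, .var 0, .var 2⟩] ++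
          pairAtoms (.var 3) (.var 1) (.var 2), [],
        ⟨codeName (.pair f g), .var 0, .var 3⟩⟩]
  | .comp f g => codeRules f ++ codeRules g ++
      [⟨[⟨codeName g, .var 0, .var 1⟩, ⟨codeName f, .var 1, .var 2⟩], [],
        ⟨codeName (.comp f g), .var 0, .var 2⟩⟩]
  | .prec f g => codeRules f ++ codeRules g ++
      [⟨pairAtoms (.var 0) (.var 1) (.const 0) ++ [⟨codeName f, .var 1, .var 2⟩], [],
        ⟨codeName (.prec f g), .var 0, .var 2⟩⟩,
      -- With parameter `x`, counter `n` and previous value `i`, variables 1, 2 and 4 are `x`, `n`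
      -- and `i`; variables 0, 3, 5 and 6 are the pairs `(x, n + 1)`, `(x, n)`, `(n, i)` and `(x,
      -- (n, i))`.
      ⟨pairAtoms (.var 0) (.var 1) (.add (.var 2) (.const 1)) ++
          pairAtoms (.var 3) (.var 1) (.var 2) ++ [⟨codeName (.prec f g), .var 3, .var 4⟩] ++
          pairAtoms (.var 5) (.var 2) (.var 4) ++ pairAtoms (.var 6) (.var 1) (.var 5) ++
          [⟨codeName g, .var 6, .var 7⟩], [],
        ⟨codeName (.prec f g), .var 0, .var 7⟩⟩]
  | .rfind' f => codeRules f ++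
      [⟨pairAtoms (.var 0) (.var 1) (.var 2) ++ [⟨codeName f, .var 0, .const 0⟩], [],
        ⟨codeName (.rfind' f), .var 0, .var 2⟩⟩,
      -- A nonzero value is matched as a successor, which avoids negation; the search then continues
      -- from the next candidate.
      ⟨pairAtoms (.var 0) (.var 1) (.var 2) ++
          [⟨codeName f, .var 0, .add (.var 3) (.const 1)⟩] ++
          pairAtoms (.var 4) (.var 1) (.add (.var 2) (.const 1)) ++
          [⟨codeName (.rfind' f), .var 4, .var 5⟩], [],
        ⟨codeName (.rfind' f), .var 0, .var 5⟩⟩]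

/-! ### Correctness of the rules for partial recursive functions -/

theorem pair_of_lt {a b : ℕ} (h : a < b) : Nat.pair a b = b * b + a := by
  simp [Nat.pair, h]

theorem pair_of_le {a b : ℕ} (h : b ≤ a) : Nat.pair a b = a * a + a + b := by
  simp [Nat.pair, not_lt.2 h]

theorem mem_eval_left {k a : ℕ} : a ∈ Code.left.eval k ↔ a = k.unpair.1 := by
  simp [Code.eval]

theorem mem_eval_right {k a : ℕ} : a ∈ Code.right.eval k ↔ a = k.unpair.2 := by
  simp [Code.eval]

theorem valid_pairingRules : ∀ r ∈ pairingRules, r.Valid stdRel := by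
  simp only [pairingRules, List.forall_mem_cons, RelRule.Valid, RelAtom.Holds, stdRel_square,
    stdRel_code, mem_eval_left, mem_eval_right, NatTerm.eval]
  refine ⟨by simp, fun v h _ => ?_, fun v h hc => ?_, fun v h hc => ?_, fun v h hc => ?_,
    fun v h hc => ?_, by simp⟩
  · rw [h.1]; ring
  · rw [h.1, ← pair_of_lt hc.1, Nat.unpair_pair]
  · rw [h.1, ← pair_of_lt hc.1, Nat.unpair_pair]
  · rw [h.1, ← pair_of_le hc.1, Nat.unpair_pair]
  · rw [h.1, ← pair_of_le hc.1, Nat.unpair_pair]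

/-- Squares follow from `(n + 1) ^ 2 = n ^ 2 + n + (n + 1)`; the two cases in the definition of
`Nat.pair` then match the two comparison conditions. -/
theorem pairingRules_complete {G : ℕ → ℕ → ℕ → Prop} (h : ∀ r ∈ pairingRules, r.Valid G)
    (a b : ℕ) : G (codeName .left) (Nat.pair a b) a ∧ G (codeName .right) (Nat.pair a b) b := by
  simp only [pairingRules, List.forall_mem_cons, List.not_mem_nil, RelRule.Valid, RelAtom.Holds,
    NatTerm.eval] at h
  obtain ⟨hs0, hs1, hl1, hr1, hl2, hr2, -⟩ := h
  have hs : ∀ n, G squareName n (n * n) := by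
    intro n
    induction n with
    | zero => simpa using hs0 fun _ => 0
    | succ n ih =>
      rw [show (n + 1) * (n + 1) = n * n + (n + (n + 1)) by ring]
      exact hs1 (fun | 0 => n | _ => n * n) ⟨ih, by simp⟩ (by simp)
  rcases lt_or_ge a b with hab | hab
  · let v : ℕ → ℕ := fun | 0 => a | 1 => b | _ => b * b
    rw [pair_of_lt hab]
    exact ⟨hl1 v ⟨hs b, by simp⟩ ⟨hab, by simp⟩, hr1 v ⟨hs b, by simp⟩ ⟨hab, by simp⟩⟩
  · let v : ℕ → ℕ := fun | 0 => a | 1 => b | _ => a * a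
    rw [pair_of_le hab]
    exact ⟨hl2 v ⟨hs a, by simp⟩ ⟨hab, by simp⟩, hr2 v ⟨hs a, by simp⟩ ⟨hab, by simp⟩⟩

/-- Failure of a candidate is phrased as having a successor value, as in the rules, and `n` counts
the failed candidates, which allows induction on the length of the search. -/
theorem mem_eval_rfind' {f : Code} {a m k : ℕ} :
    k ∈ (Code.rfind' f).eval (Nat.pair a m) ↔ ∃ n, k = n + m ∧ 0 ∈ f.eval (Nat.pair a (n + m)) ∧
      ∀ j < n, ∃ v, v + 1 ∈ f.eval (Nat.pair a (j + m)) := by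
  simp only [Code.eval, Nat.unpaired, Nat.unpair_pair, Part.mem_map_iff]
  refine exists_congr fun n => ?_
  refine (and_congr_left' Nat.mem_rfind).trans ?_
  have hzero : ∀ p : Part ℕ, true ∈ (fun m => decide (m = 0)) <$> p ↔ 0 ∈ p := by
    simp [Part.map_eq_map]
  have hsucc : ∀ p : Part ℕ, false ∈ (fun m => decide (m = 0)) <$> p ↔ ∃ v, v + 1 ∈ p := by
    intro p
    simp only [Part.map_eq_map, Part.mem_map_iff, decide_eq_false_iff_not]
    constructor
    · rintro ⟨m, hm, hne⟩
      exact ⟨m - 1, by rwa [Nat.sub_add_cancel (Nat.pos_of_ne_zero hne)]⟩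
    · rintro ⟨v, hv⟩
      exact ⟨v + 1, hv, by omega⟩
  simp only [hzero, hsucc]
  constructor
  · rintro ⟨⟨h₁, h₂⟩, rfl⟩
    exact ⟨rfl, h₁, h₂⟩
  · rintro ⟨rfl, h₁, h₂⟩
    exact ⟨⟨h₁, h₂⟩, rfl⟩

theorem eq_pair_of_eq_unpair {k a b : ℕ} (ha : a = k.unpair.1) (hb : b = k.unpair.2) :
    k = Nat.pair a b := by
  rw [ha, hb, Nat.pair_unpair]

theorem mem_eval_pair {f g : Code} {n k : ℕ} :
    k ∈ (Code.pair f g).eval n ↔ ∃ a ∈ f.eval n, ∃ b ∈ g.eval n, k = Nat.pair a b := by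
  simp [Code.eval, Seq.seq, eq_comm]

theorem mem_eval_comp {f g : Code} {n k : ℕ} :
    k ∈ (Code.comp f g).eval n ↔ ∃ a ∈ g.eval n, k ∈ f.eval a :=
  Part.mem_bind_iff

theorem mem_eval_prec_succ {f g : Code} {a n k : ℕ} :
    k ∈ (Code.prec f g).eval (Nat.pair a (n + 1)) ↔
      ∃ i ∈ (Code.prec f g).eval (Nat.pair a n), k ∈ g.eval (Nat.pair a (Nat.pair n i)) := by
  rw [← Nat.succ_eq_add_one, Code.eval_prec_succ]
  simp

/-- Each rule is one direction of the recursion equation of its constructor. Since the graphs are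
given in advance, structural induction only collects the rules of the subcodes; no induction on
computations is needed. -/
theorem valid_codeRules (c : Code) : ∀ r ∈ codeRules c, r.Valid stdRel := by
  induction c with
  | zero =>
    simp [codeRules, RelRule.Valid, RelAtom.Holds, stdRel_code, NatTerm.eval, Code.eval, pure,
      PFun.pure]
  | succ =>
    simp [codeRules, RelRule.Valid, RelAtom.Holds, stdRel_code, NatTerm.eval, Code.eval]
  | left => simp [codeRules]
  | right => simp [codeRules]
  | pair f g hf hg =>
    simp only [codeRules, List.forall_mem_append, List.forall_mem_singleton]
    refine ⟨⟨hf, hg⟩, fun v h _ => ?_⟩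
    simp only [pairAtoms, List.forall_mem_append, List.forall_mem_cons, RelAtom.Holds, stdRel_code,
      mem_eval_left, mem_eval_right, NatTerm.eval] at h ⊢
    obtain ⟨⟨h₁, h₂, -⟩, h₃, h₄, -⟩ := h
    exact mem_eval_pair.2 ⟨_, h₁, _, h₂, eq_pair_of_eq_unpair h₃ h₄⟩
  | comp f g hf hg =>
    simp only [codeRules, List.forall_mem_append, List.forall_mem_singleton]
    refine ⟨⟨hf, hg⟩, fun v h _ => ?_⟩
    simp only [List.forall_mem_cons, RelAtom.Holds, stdRel_code, NatTerm.eval] at h ⊢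
    exact mem_eval_comp.2 ⟨_, h.1, h.2.1⟩
  | prec f g hf hg =>
    simp only [codeRules, List.forall_mem_append, List.forall_mem_cons]
    refine ⟨⟨hf, hg⟩, fun v h _ => ?_, fun v h _ => ?_, by simp⟩
    · simp only [pairAtoms, List.forall_mem_append, List.forall_mem_cons, RelAtom.Holds,
        stdRel_code, mem_eval_left, mem_eval_right, NatTerm.eval] at h ⊢
      obtain ⟨⟨h₁, h₂, -⟩, h₃, -⟩ := h
      rwa [eq_pair_of_eq_unpair h₁ h₂, Code.eval_prec_zero]
    · simp only [pairAtoms, List.forall_mem_append, List.forall_mem_cons, RelAtom.Holds,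
        stdRel_code, mem_eval_left, mem_eval_right, NatTerm.eval] at h ⊢
      obtain ⟨⟨⟨⟨⟨⟨h₁, h₂, -⟩, h₃, h₄, -⟩, h₅, -⟩, h₆, h₇, -⟩, h₈, h₉, -⟩, h, -⟩ := h
      rw [eq_pair_of_eq_unpair h₃ h₄] at h₅
      rw [eq_pair_of_eq_unpair h₈ h₉, eq_pair_of_eq_unpair h₆ h₇] at h
      rw [eq_pair_of_eq_unpair h₁ h₂]
      exact mem_eval_prec_succ.2 ⟨_, h₅, h⟩
  | rfind' f hf =>
    simp only [codeRules, List.forall_mem_append, List.forall_mem_cons]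
    refine ⟨hf, fun v h _ => ?_, fun v h _ => ?_, by simp⟩
    · simp only [pairAtoms, List.forall_mem_append, List.forall_mem_cons, RelAtom.Holds,
        stdRel_code, mem_eval_left, mem_eval_right, NatTerm.eval] at h ⊢
      obtain ⟨⟨h₁, h₂, -⟩, h₃, -⟩ := h
      rw [eq_pair_of_eq_unpair h₁ h₂] at h₃ ⊢
      exact mem_eval_rfind'.2 ⟨0, by simp, by simpa using h₃, by simp⟩
    · simp only [pairAtoms, List.forall_mem_append, List.forall_mem_cons, RelAtom.Holds,
        stdRel_code, mem_eval_left, mem_eval_right, NatTerm.eval] at h ⊢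
      obtain ⟨⟨⟨⟨h₁, h₂, -⟩, h₃, -⟩, h₄, h₅, -⟩, h₆, -⟩ := h
      rw [eq_pair_of_eq_unpair h₁ h₂] at h₃ ⊢
      rw [eq_pair_of_eq_unpair h₄ h₅] at h₆
      obtain ⟨n, hk, hn, hlt⟩ := mem_eval_rfind'.1 h₆
      -- The current candidate fails and is the case `j = 0`; the later ones are those of the search
      -- begun one step further.
      refine mem_eval_rfind'.2 ⟨n + 1, by omega, ?_, fun j hj => ?_⟩
      · rwa [add_right_comm, add_assoc]
      · cases j with
        | zero => exact ⟨_, by simpa using h₃⟩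
        | succ j =>
          obtain ⟨w, hw⟩ := hlt j (by omega)
          exact ⟨w, by rwa [add_right_comm, add_assoc]⟩

/-- Induction on the code, with an inner induction on the recursion counter for `prec` and on the
length of the search for `rfind'`; every step of the computation is one application of a rule. -/
theorem codeRules_complete {G : ℕ → ℕ → ℕ → Prop} (hp : ∀ r ∈ pairingRules, r.Valid G) (c : Code)
    (hc : ∀ r ∈ codeRules c, r.Valid G) {a b : ℕ} (h : b ∈ c.eval a) : G (codeName c) a b := by
  have hl : ∀ x y, G (codeName .left) (Nat.pair x y) x := fun x y =>
    (pairingRules_complete hp x y).1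
  have hr : ∀ x y, G (codeName .right) (Nat.pair x y) y := fun x y =>
    (pairingRules_complete hp x y).2
  induction c generalizing a b with
  | zero =>
    obtain rfl : b = 0 := by simpa [Code.eval, pure, PFun.pure] using h
    exact hc _ List.mem_cons_self (fun _ => a) (by simp) (by simp)
  | succ =>
    obtain rfl : b = a + 1 := by simpa [Code.eval] using h
    exact hc _ List.mem_cons_self (fun _ => a) (by simp) (by simp)
  | left =>
    rw [mem_eval_left] at h
    simpa [h] using hl a.unpair.1 a.unpair.2
  | right =>
    rw [mem_eval_right] at h
    simpa [h] using hr a.unpair.1 a.unpair.2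
  | pair f g hf hg =>
    simp only [codeRules, List.forall_mem_append, List.forall_mem_singleton] at hc
    obtain ⟨x, hx, y, hy, rfl⟩ := mem_eval_pair.1 h
    refine hc.2 (fun | 0 => a | 1 => x | 2 => y | _ => Nat.pair x y) ?_ (by simp)
    simp only [pairAtoms, List.forall_mem_append, List.forall_mem_cons, RelAtom.Holds,
      NatTerm.eval]
    exact ⟨⟨hf hc.1.1 hx, hg hc.1.2 hy, by simp⟩, hl _ _, hr _ _, by simp⟩
  | comp f g hf hg =>
    simp only [codeRules, List.forall_mem_append, List.forall_mem_singleton] at hc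
    obtain ⟨x, hx, hb⟩ := mem_eval_comp.1 h
    refine hc.2 (fun | 0 => a | 1 => x | _ => b) ?_ (by simp)
    simp only [List.forall_mem_cons, RelAtom.Holds, NatTerm.eval]
    exact ⟨hg hc.1.2 hx, hf hc.1.1 hb, by simp⟩
  | prec f g hf hg =>
    simp only [codeRules, List.forall_mem_append, List.forall_mem_cons] at hc
    obtain ⟨⟨hcf, hcg⟩, h0, h1, -⟩ := hc
    obtain ⟨x, n, rfl⟩ : ∃ x n, a = Nat.pair x n := ⟨_, _, (Nat.pair_unpair a).symm⟩
    induction n generalizing b with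
    | zero =>
      rw [Code.eval_prec_zero] at h
      refine h0 (fun | 0 => Nat.pair x 0 | 1 => x | _ => b) ?_ (by simp)
      simp only [pairAtoms, List.forall_mem_append, List.forall_mem_cons, RelAtom.Holds,
        NatTerm.eval]
      exact ⟨⟨hl _ _, hr _ _, by simp⟩, hf hcf h, by simp⟩
    | succ n ih =>
      obtain ⟨i, hi, hb⟩ := mem_eval_prec_succ.1 h
      let v : ℕ → ℕ := fun
        | 0 => Nat.pair x (n + 1) | 1 => x | 2 => n | 3 => Nat.pair x n | 4 => i
        | 5 => Nat.pair n i | 6 => Nat.pair x (Nat.pair n i) | _ => b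
      refine h1 v ?_ (by simp)
      simp only [pairAtoms, List.forall_mem_append, List.forall_mem_cons, RelAtom.Holds,
        NatTerm.eval]
      exact ⟨⟨⟨⟨⟨⟨hl _ _, hr _ _, by simp⟩, hl _ _, hr _ _, by simp⟩, ih hi, by simp⟩,
        hl _ _, hr _ _, by simp⟩, hl _ _, hr _ _, by simp⟩, hg hcg hb, by simp⟩
  | rfind' f hf =>
    simp only [codeRules, List.forall_mem_append, List.forall_mem_cons] at hc
    obtain ⟨hcf, h0, h1, -⟩ := hc
    obtain ⟨x, m, rfl⟩ : ∃ x m, a = Nat.pair x m := ⟨_, _, (Nat.pair_unpair a).symm⟩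
    obtain ⟨n, rfl, hn, hlt⟩ := mem_eval_rfind'.1 h
    clear h
    -- The starting point `m` must vary: the remaining search is shorter by one but starts at `m +
    -- 1`.
    induction n generalizing m with
    | zero =>
      rw [zero_add] at hn ⊢
      refine h0 (fun | 0 => Nat.pair x m | 1 => x | _ => m) ?_ (by simp)
      simp only [pairAtoms, List.forall_mem_append, List.forall_mem_cons, RelAtom.Holds,
        NatTerm.eval]
      exact ⟨⟨hl _ _, hr _ _, by simp⟩, hf hcf hn, by simp⟩
    | succ n ih =>
      obtain ⟨w, hw⟩ := hlt 0 (by omega)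
      rw [zero_add] at hw
      have hrec := ih (m + 1) (by rwa [← add_assoc, add_right_comm]) fun j hj => by
        obtain ⟨w, hw⟩ := hlt (j + 1) (by omega)
        exact ⟨w, by rwa [← add_assoc, add_right_comm]⟩
      rw [← add_assoc, add_right_comm] at hrec
      let v : ℕ → ℕ := fun
        | 0 => Nat.pair x m | 1 => x | 2 => m | 3 => w | 4 => Nat.pair x (m + 1)
        | _ => n + 1 + m
      refine h1 v ?_ (by simp)
      simp only [pairAtoms, List.forall_mem_append, List.forall_mem_cons, RelAtom.Holds,
        NatTerm.eval]
      exact ⟨⟨⟨⟨hl _ _, hr _ _, by simp⟩, hf hcf hw, by simp⟩, hl _ _, hr _ _, by simp⟩,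
        hrec, by simp⟩

/-! ## The reduction -/

/-- The program computing the graph of the function with code `c`. -/
def codeProgram (c : Code) : Program :=
  unaryRules ++ (pairingRules ++ codeRules c).map RelRule.toRule

theorem admissible_codeProgram (c : Code) : ∀ r ∈ codeProgram c, r.Admissible := by
  intro r hr
  rcases List.mem_append.1 hr with hr | hr
  · exact admissible_unaryRules r hr
  · obtain ⟨s, -, rfl⟩ := List.mem_map.1 hr
    exact s.admissible_toRule

def stdExt : ℕ → Set ℤ
  | 0 => {z | 0 ≤ z}
  | 1 => {z | ∃ k : ℕ, z = ((2 ^ k : ℕ) : ℤ)}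
  | 2 => {z | ∃ k : ℕ, z = ((2 ^ k + k : ℕ) : ℤ)}
  | X + 3 => {z | ∃ a b, stdRel X a b ∧ z = code a b}

/-- The intended interpretation of all predicates of the programs `codeProgram c`. -/
def stdInterpretation : Interpretation where
  facts := {f | ∃ X, ∃ z ∈ stdExt X, f = unaryFact X z}
  wellSorted := by
    rintro _ ⟨X, z, -, rfl⟩
    rfl

theorem ext_stdInterpretation (X : ℕ) : stdInterpretation.ext X = stdExt X := by
  ext z
  constructor
  · rintro ⟨Y, w, hw, h⟩
    simp only [unaryFact, unaryPred, Fact.mk.injEq, Predicate.mk.injEq, and_true,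
      List.cons.injEq, Constant.int.injEq] at h
    rwa [h.1, h.2]
  · exact fun h => ⟨X, z, h, rfl⟩

theorem isModel_stdInterpretation (c : Code) : stdInterpretation.IsModel (codeProgram c) := by
  have hnat : ∀ z, z ∈ stdInterpretation.ext natName ↔ 0 ≤ z := fun z => by
    rw [ext_stdInterpretation]; rfl
  have hpow : ∀ z, z ∈ stdInterpretation.ext powName ↔ ∃ k : ℕ, z = ((2 ^ k : ℕ) : ℤ) :=
    fun z => by rw [ext_stdInterpretation]; rfl
  have hexp : ∀ z, z ∈ stdInterpretation.ext expName ↔ ∃ k : ℕ, z = ((2 ^ k + k : ℕ) : ℤ) :=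
    fun z => by rw [ext_stdInterpretation]; rfl
  intro r hr
  rcases List.mem_append.1 hr with hr | hr
  · exact unaryRules_sound hnat hpow hexp r hr
  · obtain ⟨s, hs, rfl⟩ := List.mem_map.1 hr
    refine RelRule.satisfiesRule_toRule (G := stdRel) (fun z => (hnat z).1) (fun z => (hpow z).1)
      (fun z => (hexp z).1) (fun A _ z hz => ?_) (fun a b hab => ?_) ?_
    · rwa [ext_stdInterpretation] at hz
    · rw [Interpretation.rel, ext_stdInterpretation]
      exact ⟨a, b, hab, rfl⟩
    · rcases List.mem_append.1 hs with hs | hs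
      · exact valid_pairingRules s hs
      · exact valid_codeRules c s hs

/-- The fact stating that the function with code `c` maps `a` to `b`. -/
def graphFact (c : Code) (a b : ℕ) : Fact := unaryFact (codeName c + 3) (code a b)

/-- Entailment is tested on the intended model, where injectivity of `code` recovers the pair;
conversely, every model contains the graph by completeness. -/
theorem entails_graphFact {c : Code} {a b : ℕ} :
    (codeProgram c).Entails (graphFact c a b) ↔ b ∈ c.eval a := by
  constructor
  · intro h
    have hmem : (code a b : ℤ) ∈ stdInterpretation.ext (codeName c + 3) :=
      h _ (isModel_stdInterpretation c)
    rw [ext_stdInterpretation] at hmem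
    obtain ⟨a', b', hab, heq⟩ := hmem
    obtain ⟨rfl, rfl⟩ := code_inj (Int.ofNat_inj.1 heq)
    exact stdRel_code.1 hab
  · intro h I hI
    obtain ⟨hnat, hpow, hexp⟩ := unaryRules_complete (I := I) fun r hr =>
      hI r (List.mem_append_left _ hr)
    have hvalid : ∀ r ∈ pairingRules ++ codeRules c, r.Valid I.rel := fun r hr =>
      RelRule.valid_of_satisfiesRule hnat hpow hexp
        (hI _ (List.mem_append_right _ (List.mem_map_of_mem hr)))
    exact codeRules_complete (fun r hr => hvalid r (List.mem_append_left _ hr)) c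
      (fun r hr => hvalid r (List.mem_append_right _ hr)) h

theorem primrec_code_zero : Primrec fun n : ℕ => code n 0 := by
  have hpow : Primrec fun n : ℕ => 2 ^ n :=
    (Primrec.nat_rec₁ 1 (Primrec.nat_double.comp Primrec.snd).to₂).of_eq fun n => by
      induction n with
      | zero => rfl
      | succ n ih => rw [pow_succ', ← ih]
  exact Primrec.nat_add.comp hpow Primrec.id

/-- The encoding of the integers sends a natural number `n` to `2 * n`. -/
theorem primrec_natCast_int : Primrec fun n : ℕ => (n : ℤ) :=
  Primrec.encode_iff.1 (Primrec.nat_double.of_eq fun _ => rfl)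

theorem primrec_graphFact_zero (c : Code) : Primrec fun n : ℕ => graphFact c n 0 := by
  have hint : Primrec Constant.int :=
    (Primrec.of_equiv_symm (e := Constant.equivSum)).comp Primrec.sumInr
  have hfact : Primrec fun p : Predicate × List Constant => Fact.mk p.1 p.2 :=
    Primrec.of_equiv_symm (e := Fact.equivProd)
  exact hfact.comp (Primrec.pair (Primrec.const _) (Primrec.list_cons.comp
    (hint.comp (primrec_natCast_int.comp primrec_code_zero)) (Primrec.const [])))

/-- A code whose function halts, with value `0`, exactly on the codes that halt on input `0`. -/
theorem exists_code_halting : ∃ u : Code, ∀ c : Code,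
    0 ∈ u.eval (Encodable.encode c) ↔ (c.eval 0).Dom := by
  have h : Partrec fun n : ℕ => ((Denumerable.ofNat Code n).eval 0).map fun _ => 0 :=
    (Code.eval_part.comp (Computable.ofNat Code) (Computable.const 0)).map (Computable.const 0).to₂
  obtain ⟨u, hu⟩ := Code.exists_code.1 (Partrec.nat_iff.1 h)
  refine ⟨u, fun c => ?_⟩
  simp [hu, Part.dom_iff_mem]

end DatalogZ

open DatalogZ

/-- There is no algorithm that decides `P ⊨ α` correctly for all facts `α` and all programs `P`
without `×` and `-` in which each standard atom has at most one numeric term. -/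
theorem mainTheorem7 :
    ¬ ∃ D : DatalogZ.Program × DatalogZ.Fact → Prop, ComputablePred D ∧
      ∀ (P : DatalogZ.Program) (α : DatalogZ.Fact),
        P.WellFormed → P.NoSubMul → P.AtMostOneNumericTerm → α.WellSorted →
          (D (P, α) ↔ P.Entails α) := by
  rintro ⟨D, hD, h⟩
  obtain ⟨u, hu⟩ := exists_code_halting
  -- The program is constant in the reduction; only the fact depends on `c`, so computability
  -- concerns `graphFact` alone.
  refine ComputablePred.halting_problem 0 (ComputablePred.computable_of_manyOneReducible
    ⟨fun c => (codeProgram u, graphFact u (Encodable.encode c) 0), ?_, fun c => ?_⟩ hD)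
  · exact (Computable.const _).pair ((primrec_graphFact_zero u).to_comp.comp Computable.encode)
  · have hadm := admissible_codeProgram u
    rw [h _ (graphFact u (Encodable.encode c) 0) (fun r hr => (hadm r hr).wellFormed)
      (fun r hr => (hadm r hr).noSubMul)
      (fun r hr => (hadm r hr).atMostOne) rfl, entails_graphFact, hu]
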